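/- Let $k$ be a field, let $G$ be an algebraic group over $k$ (a $k$-group scheme of finite type), and let $H$ be an étale $k$-group scheme (not necessarily of finite type). For a $k$-scheme $X$, let $\mathbf{Hom}(X,H)$ be the contravariant group functor on $k$-schemes that sends $S$ to the group $\mathrm{Hom}_k(X\times_k S,\,H)\cong \mathrm{Hom}_S(X\times_k S,\,H\times_k S)$, with pointwise multiplication in $H$, and sends $u:S'\to S$ to $f\mapsto f\circ(\mathrm{id}_X\times u)$. Let $\pi_0(G)=\operatorname{Spec}\pi(\mathcal O(G))$ be the étale scheme of connected components of $G$, where $\pi(\mathcal O(G))$ is the largest étale $k$-subalgebra of $\mathcal O(G)=\Gamma(G,\mathcal O_G)$, and let $\gamma:G\to\pi_0(G)$ be the canonical morphism, given by the inclusion $\pi(\mathcal O(G))\subseteq\mathcal O(G)$. (i) The pullback $\gamma^*:\mathbf{Hom}(\pi_0(G),H)\to\mathbf{Hom}(G,H)$, $f\mapsto f\circ(\gamma\times\mathrm{id}_S)$, is an isomorphism of group functors. (ii) The group functor $\mathbf{Hom}(G,H)$ is represented by an étale $k$-group scheme $N$. If $H$ is finite over $k$, then $N$ is finite over $k$ as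 well. -/

import Mathlib

universe u

open CategoryTheory MonoidalCategory AlgebraicGeometry Opposite

noncomputable section

namespace HomEtale

section Algebra

variable (k : Type u) [Field k] (A : Type u) [CommRing A] [Algebra k A]

/-- The largest étale subalgebra `π(A)` of a `k`-algebra `A`: the subalgebra generated by all
étale `k`-subalgebras. -/
def maxEtaleSubalgebra : Subalgebra k A :=
  sSup {B : Subalgebra k A | Algebra.Etale k B}

end Algebra

variable {k : Type u} [Field k]

/-- The ring `𝒪(X)` of global functions of a `k`-scheme `X`. -/
def GlobalFunctions (X : Over (Spec (.of k))) : Type u := Γ(X.left, ⊤)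

instance (X : Over (Spec (.of k))) : CommRing (GlobalFunctions X) :=
  inferInstanceAs (CommRing Γ(X.left, ⊤))

/-- `𝒪(X)` is a `k`-algebra through the structural morphism `X ⟶ Spec k`. -/
instance (X : Over (Spec (.of k))) : Algebra k (GlobalFunctions X) :=
  RingHom.toAlgebra (S := GlobalFunctions X)
    ((Scheme.ΓSpecIso (.of k)).inv ≫ X.hom.appTop).hom

/-- The scheme of connected components `π₀(X)` of a `k`-scheme `X` of finite type: the spectrum
of the largest étale subalgebra of `𝒪(X)`. -/
def piZero (X : Over (Spec (.of k))) : Over (Spec (.of k)) :=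
  Over.mk (Spec.map (CommRingCat.ofHom
    (algebraMap k (maxEtaleSubalgebra k (GlobalFunctions X)))))

/-- The inclusion of the largest étale subalgebra into `𝒪(X)`. -/
def piZeroInclusion (X : Over (Spec (.of k))) :
    CommRingCat.of (maxEtaleSubalgebra k (GlobalFunctions X)) ⟶ Γ(X.left, ⊤) :=
  CommRingCat.ofHom (S := Γ(X.left, ⊤))
    (maxEtaleSubalgebra k (GlobalFunctions X)).val.toRingHom

theorem algebraMap_piZeroInclusion (X : Over (Spec (.of k))) :
    CommRingCat.ofHom (algebraMap k (maxEtaleSubalgebra k (GlobalFunctions X))) ≫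
      piZeroInclusion X = (Scheme.ΓSpecIso (.of k)).inv ≫ X.hom.appTop := rfl

/-- The canonical morphism `γ : X ⟶ π₀(X)` over `k`, given by the inclusion of the largest étale
subalgebra into `𝒪(X)`. -/
def toPiZero (X : Over (Spec (.of k))) : X ⟶ piZero X :=
  Over.homMk (X.left.toSpecΓ ≫ Spec.map (piZeroInclusion X))
    (by
      change (X.left.toSpecΓ ≫ Spec.map _) ≫ Spec.map _ = X.hom
      rw [Category.assoc, ← Spec.map_comp, algebraMap_piZeroInclusion, Spec.map_comp,
        ← Scheme.toSpecΓ_naturality_assoc]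
      simp)

/-- The group functor `𝐇𝐨𝐦(X, H)` on `k`-schemes, for a `k`-scheme `X` and a `k`-group scheme `H`:
it sends `S` to the group of `k`-morphisms `X × S ⟶ H` under pointwise multiplication in `H`, and
`u : S' ⟶ S` to precomposition with `(id, u) : X × S' ⟶ X × S`. -/
def homFunctor (X H : Over (Spec (.of k))) [GrpObj H] :
    (Over (Spec (.of k)))ᵒᵖ ⥤ GrpCat.{u} :=
  (tensorLeft X).op ⋙ yonedaGrpObj H

/-- The pullback `φ^* : 𝐇𝐨𝐦(X, H) ⟶ 𝐇𝐨𝐦(X', H)` along `φ : X' ⟶ X`, sending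
`f : X × S ⟶ H` to `f ∘ (φ, id) : X' × S ⟶ H`. -/
def homFunctorPullback {X' X : Over (Spec (.of k))} (φ : X' ⟶ X)
    (H : Over (Spec (.of k))) [GrpObj H] : homFunctor X H ⟶ homFunctor X' H :=
  Functor.whiskerRight (NatTrans.op ((curriedTensor _).map φ)) (yonedaGrpObj H)

end HomEtale

end

/-!
The `k`-algebra `π(𝒪(X))` is finite étale, and it stays the largest étale subalgebra after a field
extension: an idempotent of `K ⊗ 𝒪(X)` has its coefficients in a finite étale subalgebra of `𝒪(X)`.
Hence `γ : X ⟶ π₀(X)` is flat and quasi-compact with geometrically connected fibres, and so are its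
base changes. Two morphisms to the étale scheme `H` that agree at a point of a connected scheme
coincide, so a morphism `X × S ⟶ H` agrees on the two projections from the fibre product of `X × S`
with itself over `π₀(X) × S`, and it descends by faithfully flat descent.

This reduces the representability to that of `𝐇𝐨𝐦(E, H)` for `E` finite étale over `k`. If `H` is
affine, it is the Weil restriction of `E × H` from `E` to `k`, which is étale because étaleness is a
lifting property along nilpotent thickenings. In general `H` is a discrete space, and for
`f : E × T ⟶ H` the image of the fibre over `t : T` is a finite subset `U` of `H`, locally constant
in `t`. For a fixed `U` the morphisms are represented by an open subscheme of `𝐇𝐨𝐦(E, U)` with `U`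
affine, and `𝐇𝐨𝐦(E, H)` is the disjoint union of these over all `U`.
-/

noncomputable section

namespace HomEtale

open scoped TensorProduct

section Idempotents

theorem derivation_apply_eq_zero_of_isIdempotentElem {R A M : Type*} [CommRing R] [CommRing A]
    [Algebra R A] [AddCommGroup M] [Module A M] [Module R M] (D : Derivation R A M) {e : A}
    (he : IsIdempotentElem e) : D e = 0 := by
  have leibniz : D e = e • D e + e • D e := by
    conv_lhs => rw [← he.eq]
    exact D.leibniz e e
  have smul_eq_zero : e • D e = 0 := by
    simpa only [smul_add, ← mul_smul, he.eq, left_eq_add] using congrArg (e • ·) leibniz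
  rw [leibniz, smul_eq_zero, add_zero]

theorem formallyUnramified_of_adjoin_eq_top {R A : Type*} [CommRing R] [CommRing A] [Algebra R A]
    {s : Set A} (hs : Algebra.adjoin R s = ⊤) (hD : ∀ x ∈ s, KaehlerDifferential.D R A x = 0) :
    Algebra.FormallyUnramified R A := by
  have D_eq_zero : KaehlerDifferential.D R A = 0 :=
    Derivation.ext_of_adjoin_eq_top s hs fun x hx ↦ hD x hx
  refine ⟨(Submodule.subsingleton_iff A).mp (subsingleton_of_bot_eq_top ?_)⟩
  rw [← KaehlerDifferential.span_range_derivation R A, D_eq_zero, eq_comm, Submodule.span_eq_bot]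
  rintro _ ⟨x, rfl⟩
  rfl

variable {R : Type*} [CommRing R] {ι K : Type*} [DecidableEq ι] [CommRing K] [Algebra R K]

theorem equivFinsuppOfBasisLeft_lTensor (b : Module.Basis ι R K) {M N : Type*} [AddCommGroup M]
    [Module R M] [AddCommGroup N] [Module R N] (f : M →ₗ[R] N) (z : K ⊗[R] M) (i : ι) :
    TensorProduct.equivFinsuppOfBasisLeft b (f.lTensor K z) i =
      f (TensorProduct.equivFinsuppOfBasisLeft b z i) := by
  induction z with
  | zero => simp
  | tmul x m => simp
  | add z w hz hw => simp only [map_add, Finsupp.add_apply, hz, hw]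

theorem mem_range_lTensor_subtype (b : Module.Basis ι R K) {M : Type*} [AddCommGroup M]
    [Module R M] (N : Submodule R M) {z : K ⊗[R] M}
    (hz : ∀ i, TensorProduct.equivFinsuppOfBasisLeft b z i ∈ N) :
    z ∈ LinearMap.range (N.subtype.lTensor K) := by
  rw [← (TensorProduct.equivFinsuppOfBasisLeft b).symm_apply_apply z,
    TensorProduct.equivFinsuppOfBasisLeft_symm_apply]
  exact Submodule.finsuppSum_mem _ _ _ _ fun i _ ↦ ⟨b i ⊗ₜ ⟨_, hz i⟩, rfl⟩

attribute [local instance] Algebra.TensorProduct.rightAlgebra in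
theorem tensorKaehlerEquivBase_lTensor_D {B : Type*} [CommRing B] [Algebra R B] (z : K ⊗[R] B) :
    KaehlerDifferential.tensorKaehlerEquivBase R K B (K ⊗[R] B)
      ((KaehlerDifferential.D R B).toLinearMap.lTensor K z) =
        KaehlerDifferential.D K (K ⊗[R] B) z := by
  induction z with
  | zero => simp only [map_zero]
  | tmul x y =>
    rw [LinearMap.lTensor_tmul, KaehlerDifferential.tensorKaehlerEquivBase_tmul,
      Derivation.coeFn_coe, KaehlerDifferential.map_D, ← Derivation.map_smul,
      Algebra.TensorProduct.right_algebraMap_apply, TensorProduct.smul_tmul', smul_eq_mul, mul_one]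
  | add z w hz hw => simp only [map_add, hz, hw]

theorem D_equivFinsuppOfBasisLeft_eq_zero (b : Module.Basis ι R K) {B : Type*} [CommRing B]
    [Algebra R B] {e : K ⊗[R] B} (he : IsIdempotentElem e) (i : ι) :
    KaehlerDifferential.D R B (TensorProduct.equivFinsuppOfBasisLeft b e i) = 0 := by
  have lTensor_D_eq_zero : (KaehlerDifferential.D R B).toLinearMap.lTensor K e = 0 := by
    let := Algebra.TensorProduct.rightAlgebra (R := R) (A := K) (B := B)
    rw [← (KaehlerDifferential.tensorKaehlerEquivBase R K B (K ⊗[R] B)).map_eq_zero_iff,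
      tensorKaehlerEquivBase_lTensor_D, derivation_apply_eq_zero_of_isIdempotentElem _ he]
  rw [← Derivation.coeFn_coe, ← equivFinsuppOfBasisLeft_lTensor, lTensor_D_eq_zero, map_zero,
    Finsupp.zero_apply]

variable {A : Type*} [CommRing A] [Algebra R A]

/-- The subalgebra of `A` generated by the coefficients of `z : K ⊗ A` in a basis `b` of `K`. -/
def coefficientSubalgebra (b : Module.Basis ι R K) (z : K ⊗[R] A) : Subalgebra R A :=
  Algebra.adjoin R (Set.range (TensorProduct.equivFinsuppOfBasisLeft b z))

theorem finiteType_coefficientSubalgebra (b : Module.Basis ι R K) (z : K ⊗[R] A) :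
    Algebra.FiniteType R (coefficientSubalgebra b z) :=
  (coefficientSubalgebra b z).fg_iff_finiteType.mp
    (Subalgebra.fg_def.mpr ⟨_, Finsupp.finite_range _, rfl⟩)

theorem exists_map_coefficientSubalgebra_val_eq (b : Module.Basis ι R K) (z : K ⊗[R] A) :
    ∃ z' : K ⊗[R] coefficientSubalgebra b z,
      Algebra.TensorProduct.map (AlgHom.id R K) (coefficientSubalgebra b z).val z' = z :=
  mem_range_lTensor_subtype b (Subalgebra.toSubmodule (coefficientSubalgebra b z))
    fun i ↦ Algebra.subset_adjoin ⟨i, rfl⟩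

theorem formallyUnramified_coefficientSubalgebra (b : Module.Basis ι R K) {e : K ⊗[R] A}
    (he : IsIdempotentElem e) : Algebra.FormallyUnramified R (coefficientSubalgebra b e) := by
  let B := coefficientSubalgebra b e
  have : Module.Free R K := .of_basis b
  obtain ⟨e', he'⟩ := exists_map_coefficientSubalgebra_val_eq b e
  have injective_map : Function.Injective (Algebra.TensorProduct.map (AlgHom.id R K) B.val) :=
    Module.Flat.lTensor_preserves_injective_linearMap (M := K) B.val.toLinearMap
      Subtype.val_injective
  have isIdempotentElem_e' : IsIdempotentElem e' := injective_map (by rw [map_mul, he', he.eq])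
  refine formallyUnramified_of_adjoin_eq_top (A := B) Algebra.adjoin_adjoin_coe_preimage ?_
  rintro x ⟨i, hi⟩
  have x_eq : x = TensorProduct.equivFinsuppOfBasisLeft b e' i := by
    refine Subtype.ext (hi.symm.trans ?_)
    conv_lhs => rw [← he']
    exact equivFinsuppOfBasisLeft_lTensor b B.val.toLinearMap e' i
  rw [x_eq, D_equivFinsuppOfBasisLeft_eq_zero b isIdempotentElem_e']

end Idempotents

section MaxEtaleSubalgebra

variable {k : Type u} [Field k]

theorem etale_of_formallyUnramified_of_finiteType (B : Type*) [CommRing B] [Algebra k B]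
    [Algebra.FiniteType k B] [Algebra.FormallyUnramified k B] : Algebra.Etale k B where
  formallyEtale := .of_formallyUnramified_of_field k B
  finitePresentation := Algebra.FinitePresentation.of_finiteType.mp inferInstance

variable {A : Type u} [CommRing A] [Algebra k A]

theorem exists_map_maxEtaleSubalgebra_val_eq_of_isIdempotentElem {K : Type*} [CommRing K]
    [Algebra k K] {e : K ⊗[k] A} (he : IsIdempotentElem e) :
    ∃ e' : K ⊗[k] maxEtaleSubalgebra k A,
      Algebra.TensorProduct.map (AlgHom.id k K) (maxEtaleSubalgebra k A).val e' = e := by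
  classical
  let b := Module.Free.chooseBasis k K
  have := finiteType_coefficientSubalgebra b e
  have := formallyUnramified_coefficientSubalgebra b he
  have le_max : coefficientSubalgebra b e ≤ maxEtaleSubalgebra k A :=
    le_sSup (etale_of_formallyUnramified_of_finiteType (coefficientSubalgebra b e))
  obtain ⟨e', he'⟩ := exists_map_coefficientSubalgebra_val_eq b e
  refine ⟨Algebra.TensorProduct.map (AlgHom.id k K) (Subalgebra.inclusion le_max) e', ?_⟩
  rw [← AlgHom.comp_apply, ← Algebra.TensorProduct.map_comp]
  exact he'

theorem etale_range {B A : Type*} [CommRing B] [Algebra k B] [CommRing A] [Algebra k A]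
    (f : B →ₐ[k] A) [Algebra.Etale k B] : Algebra.Etale k f.range := by
  have := Algebra.FormallyUnramified.of_surjective f.rangeRestrict f.rangeRestrict_surjective
  have := Algebra.FiniteType.of_surjective f.rangeRestrict f.rangeRestrict_surjective
  exact etale_of_formallyUnramified_of_finiteType _

theorem etale_sup {A : Type*} [CommRing A] [Algebra k A] (B C : Subalgebra k A)
    [Algebra.Etale k B] [Algebra.Etale k C] : Algebra.Etale k ↥(B ⊔ C) := by
  have range_productMap : (Algebra.TensorProduct.productMap B.val C.val).range = B ⊔ C := by
    rw [Algebra.TensorProduct.productMap_range, Subalgebra.range_val, Subalgebra.range_val]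
  have : Algebra.Etale k (B ⊗[k] C) := .comp k B _
  exact range_productMap ▸ etale_range (Algebra.TensorProduct.productMap B.val C.val)

theorem card_primeSpectrum_le_ncard_minimalPrimes {B A : Type*} [CommRing B] [CommRing A]
    [IsArtinianRing B] [IsNoetherianRing A] (f : B →+* A) (hf : Function.Injective f) :
    Nat.card (PrimeSpectrum B) ≤ (minimalPrimes A).ncard := by
  have exists_minimalPrime (p : PrimeSpectrum B) :
      ∃ q ∈ minimalPrimes A, q.comap f = p.asIdeal := by
    refine Ideal.exists_minimalPrimes_comap_eq f p.asIdeal ?_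
    rw [Ideal.comap_bot_of_injective f hf]
    exact ⟨⟨p.2, bot_le⟩, fun q hq hqp ↦
      have := hq.1
      ((IsArtinianRing.isMaximal_of_isPrime q).eq_of_le p.2.ne_top hqp).ge⟩
  choose q hq hqp using exists_minimalPrime
  rw [← Set.ncard_univ]
  refine Set.ncard_le_ncard_of_injOn q (fun p _ ↦ hq p) (fun p _ p' _ h ↦ ?_)
    (minimalPrimes.finite_of_isNoetherianRing A)
  exact PrimeSpectrum.ext (by rw [← hqp, ← hqp, h])

theorem finrank_eq_card_primeSpectrum (K : Type*) [Field K] [IsSepClosed K] (B : Type*)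
    [CommRing B] [Algebra K B] [Algebra.Etale K B] :
    Module.finrank K B = Nat.card (PrimeSpectrum B) := by
  have : Module.Finite K B := Algebra.FormallyUnramified.finite_of_free K B
  have : IsArtinianRing B := isArtinian_of_tower K inferInstance
  have := Fintype.ofFinite (PrimeSpectrum B)
  rw [(Algebra.FormallyEtale.equivPiOfIsSepClosed K B).toLinearEquiv.finrank_eq,
    Module.finrank_fintype_fun_eq_card, Nat.card_eq_fintype_card]

theorem finrank_le_ncard_minimalPrimes {B A : Type u} [CommRing B] [CommRing A] [Algebra k B]
    [Algebra k A] [Algebra.Etale k B] [Algebra.FiniteType k A] (f : B →ₐ[k] A)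
    (hf : Function.Injective f) :
    Module.finrank k B ≤ (minimalPrimes (AlgebraicClosure k ⊗[k] A)).ncard := by
  let K := AlgebraicClosure k
  have : IsNoetherianRing (K ⊗[k] A) := Algebra.FiniteType.isNoetherianRing K _
  have : Module.Finite k B := Algebra.FormallyUnramified.finite_of_free k B
  have : IsArtinianRing (K ⊗[k] B) := isArtinian_of_tower K inferInstance
  rw [← Module.finrank_baseChange (R := K), finrank_eq_card_primeSpectrum]
  exact card_primeSpectrum_le_ncard_minimalPrimes
    (Algebra.TensorProduct.map (AlgHom.id k K) f).toRingHom
    (Module.Flat.lTensor_preserves_injective_linearMap (M := K) f.toLinearMap hf)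

theorem etale_maxEtaleSubalgebra {A' : Type u} [CommRing A'] [Algebra k A']
    [Algebra.FiniteType k A'] (f : A →ₐ[k] A') (hf : Function.Injective f) :
    Algebra.Etale k (maxEtaleSubalgebra k A) := by
  let S : Set (Subalgebra k A) := {B | Algebra.Etale k B}
  have finite_finrank : ((fun B : Subalgebra k A ↦ Module.finrank k B) '' S).Finite := by
    refine (Set.finite_Iic (minimalPrimes (AlgebraicClosure k ⊗[k] A')).ncard).subset ?_
    rintro _ ⟨B, hB, rfl⟩
    have : Algebra.Etale k B := hB
    exact finrank_le_ncard_minimalPrimes (f.comp B.val) (hf.comp Subtype.val_injective)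
  obtain ⟨B, hB, hmax⟩ := Set.Finite.exists_maximalFor' _ S finite_finrank
    ⟨_, etale_range (Algebra.ofId k A)⟩
  have : Algebra.Etale k B := hB
  suffices maxEtaleSubalgebra k A = B by rwa [this]
  refine le_antisymm (sSup_le fun C (hC : Algebra.Etale k C) ↦ ?_) (le_sSup hB)
  have hsup : Algebra.Etale k ↥(B ⊔ C) := etale_sup B C
  have : Module.Finite k ↥(B ⊔ C) := Algebra.FormallyUnramified.finite_of_free k _
  rw [Subalgebra.eq_of_le_of_finrank_le le_sup_left
    (hmax hsup (Submodule.finrank_mono (Subalgebra.toSubmodule.monotone le_sup_left)))]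
  exact le_sup_right

end MaxEtaleSubalgebra

section SeparabilityIdempotent

open Algebra.TensorProduct Algebra.FormallyUnramified

variable (k P K A : Type*) [CommRing k] [CommRing P] [CommRing A] [CommRing K] [Algebra k P]
  [Algebra k A] [Algebra k K] [Algebra P A] [Algebra P K] [IsScalarTower k P A]
  [IsScalarTower k P K] [Algebra.FormallyUnramified k P] [Algebra.EssFiniteType k P]

/-- The image in `K ⊗[k] A` of the separability idempotent of the unramified `k`-algebra `P`; it
cuts out the quotient `K ⊗[P] A` of `K ⊗[k] A` as a direct factor. -/
def separabilityElem : K ⊗[k] A :=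
  map (IsScalarTower.toAlgHom k P K) (IsScalarTower.toAlgHom k P A) (elem k P)

theorem mapOfCompatibleSMul_separabilityElem :
    mapOfCompatibleSMul P k K K A (separabilityElem k P K A) = 1 := by
  have comp_map_eq : ((mapOfCompatibleSMul P k K K A).restrictScalars k).comp
      (map (IsScalarTower.toAlgHom k P K) (IsScalarTower.toAlgHom k P A)) =
        ((Algebra.ofId P (K ⊗[P] A)).restrictScalars k).comp (lmul' k) := by
    ext x
    · simp [Algebra.ofId_apply, Algebra.TensorProduct.algebraMap_apply]
    · simp [Algebra.ofId_apply, Algebra.TensorProduct.algebraMap_apply, tmul_one_eq_one_tmul]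
  simpa [lmul_elem, separabilityElem, Algebra.TensorProduct.one_def]
    using DFunLike.congr_fun comp_map_eq (elem k P)

variable {A K}

theorem separabilityElem_mul_eq_zero {z : K ⊗[k] A}
    (hz : mapOfCompatibleSMul P k K K A z = 0) : separabilityElem k P K A * z = 0 := by
  have one_tmul_mul_separabilityElem (p : P) :
      (1 ⊗ₜ algebraMap P A p) * separabilityElem k P K A =
        (algebraMap P K p ⊗ₜ 1) * separabilityElem k P K A := by
    simpa [separabilityElem] using congrArg (map (IsScalarTower.toAlgHom k P K)
      (IsScalarTower.toAlgHom k P A)) (one_tmul_mul_elem (R := k) p)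
  replace hz : z ∈ LinearMap.ker (TensorProduct.mapOfCompatibleSMul P k P K A) := hz
  rw [TensorProduct.AlgebraTensorModule.ker_mapOfCompatibleSMul] at hz
  induction hz using Submodule.span_induction with
  | mem z hz =>
    obtain ⟨p, x, a, rfl⟩ := hz
    have smul_tmul : (p • x) ⊗ₜ[k] a = (algebraMap P K p ⊗ₜ 1) * (x ⊗ₜ a) := by
      rw [tmul_mul_tmul, Algebra.smul_def, one_mul]
    have tmul_smul : x ⊗ₜ[k] (p • a) = (1 ⊗ₜ algebraMap P A p) * (x ⊗ₜ a) := by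
      rw [tmul_mul_tmul, Algebra.smul_def, one_mul]
    rw [smul_tmul, tmul_smul]
    linear_combination (-(x ⊗ₜ[k] a)) * one_tmul_mul_separabilityElem p
  | zero => exact mul_zero _
  | add z w _ _ hz hw => rw [mul_add, hz, hw, add_zero]
  | smul p z _ hz => rw [mul_smul_comm, hz, smul_zero]

theorem exists_isIdempotentElem_mapOfCompatibleSMul_eq {e : K ⊗[P] A} (he : IsIdempotentElem e) :
    ∃ e' : K ⊗[k] A, IsIdempotentElem e' ∧ mapOfCompatibleSMul P k K K A e' = e := by
  let ε := separabilityElem k P K A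
  have hε : mapOfCompatibleSMul P k K K A ε = 1 := mapOfCompatibleSMul_separabilityElem k P K A
  obtain ⟨y, rfl⟩ := mapOfCompatibleSMul_surjective P k K K A e
  have ε_mul : ε * (ε * y * y - y) = 0 := by
    refine separabilityElem_mul_eq_zero k P ?_
    rw [map_sub, map_mul, map_mul, hε, one_mul, he.eq, sub_self]
  refine ⟨ε * y, ?_, by rw [map_mul, hε, one_mul]⟩
  rw [IsIdempotentElem]
  linear_combination ε_mul

variable {P}

theorem exists_algebraMap_eq_of_isIdempotentElem
    (h : ∀ e : K ⊗[k] A, IsIdempotentElem e →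
      ∃ e' : K ⊗[k] P, map (AlgHom.id k K) (IsScalarTower.toAlgHom k P A) e' = e)
    {e : K ⊗[P] A} (he : IsIdempotentElem e) : ∃ x : K, algebraMap K (K ⊗[P] A) x = e := by
  obtain ⟨e', he', rfl⟩ := exists_isIdempotentElem_mapOfCompatibleSMul_eq k P he
  obtain ⟨z, rfl⟩ := h e' he'
  have comp_map_eq : (mapOfCompatibleSMul P k K K A).comp
      (map (AlgHom.id K K) (IsScalarTower.toAlgHom k P A)) =
        (Algebra.ofId K (K ⊗[P] A)).comp
          (lift (AlgHom.id K K) (IsScalarTower.toAlgHom k P K) fun _ _ ↦ Commute.all _ _) := by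
    ext p
    simp [Algebra.TensorProduct.algebraMap_apply, tmul_one_eq_one_tmul]
  exact ⟨_, (DFunLike.congr_fun comp_map_eq z).symm⟩

end SeparabilityIdempotent

open Limits

section ConnectedFibres

theorem exists_isIdempotentElem_restrict_eq {X : Scheme.{u}} {U V W : X.Opens}
    (hUV : Disjoint U V) (hW : U ⊔ V = W) :
    ∃ e : Γ(X, W), IsIdempotentElem e ∧
      X.presheaf.map (homOfLE (le_sup_left.trans_eq hW)).op e = (1 : Γ(X, U)) ∧
      X.presheaf.map (homOfLE (le_sup_right.trans_eq hW)).op e = (0 : Γ(X, V)) := by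
  subst hW
  have : Subsingleton Γ(X, U ⊓ V) := by
    rw [hUV.eq_bot]
    infer_instance
  refine ⟨(X.sheaf.objSupIsoProdEqLocus U V).inv
    ⟨(1, 0), Subsingleton.elim (α := Γ(X, U ⊓ V)) _ _⟩, ?_,
    X.sheaf.objSupIsoProdEqLocus_inv_fst U V _, X.sheaf.objSupIsoProdEqLocus_inv_snd U V _⟩
  refine IsIdempotentElem.map ?_ (X.sheaf.objSupIsoProdEqLocus U V).inv.hom
  exact Subtype.ext (Prod.ext (one_mul 1) (zero_mul 0))

theorem eq_bot_of_subsingleton {X : Scheme.{u}} {U : X.Opens} [Subsingleton Γ(X, U)] : U = ⊥ := by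
  rw [← X.basicOpen_of_isUnit (f := (1 : Γ(X, U))) isUnit_one, Subsingleton.elim (1 : Γ(X, U)) 0,
    Scheme.basicOpen_zero]

theorem connectedSpace_of_isIdempotentElem {X : Scheme.{u}} [Nontrivial Γ(X, ⊤)]
    (h : ∀ e : Γ(X, ⊤), IsIdempotentElem e → e = 0 ∨ e = 1) : ConnectedSpace X := by
  have : Nonempty X := by
    by_contra hX
    rw [not_nonempty_iff] at hX
    exact not_subsingleton Γ(X, ⊤) inferInstance
  refine @ConnectedSpace.mk _ _ (preconnectedSpace_iff_clopen.mpr fun s hs ↦ ?_) inferInstance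
  let U : X.Opens := ⟨s, hs.isOpen⟩
  let V : X.Opens := ⟨sᶜ, hs.compl.isOpen⟩
  have disjoint_UV : Disjoint U V := by
    rw [← TopologicalSpace.Opens.coe_disjoint]
    exact disjoint_compl_right
  have sup_UV : U ⊔ V = ⊤ := TopologicalSpace.Opens.ext (Set.union_compl_self s)
  obtain ⟨e, he, heU, heV⟩ := exists_isIdempotentElem_restrict_eq disjoint_UV sup_UV
  rcases h e he with rfl | rfl
  · have : Subsingleton Γ(X, U) := subsingleton_of_zero_eq_one ((map_zero _).symm.trans heU)
    exact .inl (congrArg SetLike.coe (eq_bot_of_subsingleton (U := U)))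
  · have : Subsingleton Γ(X, V) := subsingleton_of_zero_eq_one (heV.symm.trans (map_one _))
    exact .inr (Set.compl_empty_iff.mp (congrArg SetLike.coe (eq_bot_of_subsingleton (U := V))))

end ConnectedFibres

section FlatBaseChange

theorem appLE_top_top {X Y : Scheme.{u}} (f : X ⟶ Y) (h : (⊤ : X.Opens) ≤ f ⁻¹ᵁ ⊤) :
    f.appLE ⊤ ⊤ h = f.appTop :=
  f.appLE_eq_app

theorem isPushout_appTop_of_flat {X Y S T : Scheme.{u}} {f : T ⟶ S} {g : Y ⟶ X} {iX : X ⟶ S}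
    {iY : Y ⟶ T} (H : IsPullback g iY iX f) [IsAffine S] [IsAffine T] [CompactSpace X]
    [QuasiSeparatedSpace X] [Flat f] :
    IsPushout iX.appTop f.appTop g.appTop iY.appTop := by
  have := (isIso_pushoutSection_iff H (US := ⊤) (UT := ⊤) (UX := ⊤) (UY := ⊤) le_top le_top
    (by simp)).mp (isIso_pushoutSection_of_isQuasiSeparated_of_flat_right H _ _ _
      (isAffineOpen_top S) (isAffineOpen_top T) isCompact_univ isQuasiSeparated_univ)
  convert! this using 1 <;> exact (appLE_top_top _ _).symm

theorem isPushout_of_isPullback_toSpecΓ_comp {X Y : Scheme.{u}} [CompactSpace X]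
    [QuasiSeparatedSpace X] {R K : CommRingCat.{u}} {ψ : R ⟶ Γ(X, ⊤)} {φ : R ⟶ K}
    (hφ : φ.hom.Flat) {g : Y ⟶ X} {p : Y ⟶ Spec K}
    (H : IsPullback g p (X.toSpecΓ ≫ Spec.map ψ) (Spec.map φ)) :
    IsPushout ψ φ g.appTop ((Scheme.ΓSpecIso K).inv ≫ p.appTop) := by
  have : Flat (Spec.map φ) := HasRingHomProperty.Spec_iff.mpr hφ
  refine (isPushout_appTop_of_flat H).of_iso (Scheme.ΓSpecIso R) (Iso.refl _) (Scheme.ΓSpecIso K)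
    (Iso.refl _) ?_ (Scheme.ΓSpecIso_naturality φ) ?_ ?_ <;> simp

end FlatBaseChange

section PiZero

theorem flat_of_flat_comp {X Y Z : Scheme.{u}} (f : X ⟶ Y) (g : Y ⟶ Z) [Flat (f ≫ g)]
    [hg : Etale g] : Flat f := by
  have := (MorphismProperty.hasOfPostcompProperty_iff_le_diagonal (P := @Flat) (Q := @Etale)).mpr
    fun X Y f (_ : Etale f) ↦ (inferInstance : Flat (pullback.diagonal f))
  exact this.of_postcomp f g hg ‹_›

variable {k : Type u} [Field k]

/-- The `k`-algebra homomorphism `𝒪(X) → 𝒪(Y)` induced by a `k`-morphism `Y ⟶ X`. -/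
def globalFunctionsMap {X Y : Over (Spec (.of k))} (f : Y ⟶ X) :
    GlobalFunctions X →ₐ[k] GlobalFunctions Y where
  toRingHom := f.left.appTop.hom
  commutes' r := by
    change f.left.appTop.hom (((Scheme.ΓSpecIso (.of k)).inv ≫ X.hom.appTop).hom r) =
      ((Scheme.ΓSpecIso (.of k)).inv ≫ Y.hom.appTop).hom r
    rw [← Over.w f, Scheme.Hom.comp_appTop]
    rfl

theorem finiteType_globalFunctions (X : Over (Spec (.of k))) [IsAffine X.left]
    [LocallyOfFiniteType X.hom] : Algebra.FiniteType k (GlobalFunctions X) := by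
  have finiteType_appTop : X.hom.appTop.hom.FiniteType :=
    (HasRingHomProperty.iff_of_isAffine (P := @LocallyOfFiniteType)).mp inferInstance
  exact finiteType_appTop.comp (RingHom.FiniteType.of_surjective _
    (Scheme.ΓSpecIso (.of k)).symm.commRingCatIsoToRingEquiv.surjective)

theorem app_sigmaDesc_injective {X : Scheme.{u}} (𝒰 : X.OpenCover) (U : X.Opens) :
    Function.Injective ((Sigma.desc 𝒰.f).app U) := by
  refine (injective_iff_map_eq_zero ((Sigma.desc 𝒰.f).app U).hom).mpr fun a ha ↦ ?_
  refine Scheme.zero_of_zero_cover a 𝒰 fun i ↦ ?_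
  rw [← Sigma.ι_desc 𝒰.f i, Scheme.Hom.comp_app]
  exact (congrArg ((Sigma.ι 𝒰.X i).app _).hom ha).trans (map_zero _)

variable (X : Over (Spec (.of k))) [LocallyOfFiniteType X.hom] [QuasiCompact X.hom]

theorem etale_maxEtaleSubalgebra_globalFunctions :
    Algebra.Etale k (maxEtaleSubalgebra k (GlobalFunctions X)) := by
  have : CompactSpace X.left := QuasiCompact.compactSpace_of_compactSpace X.hom
  let 𝒰 := X.left.affineCover.finiteSubcover
  let p : (∐ 𝒰.X) ⟶ X.left := Sigma.desc 𝒰.f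
  have : IsZariskiLocalAtSource @LocallyOfFiniteType :=
    HasRingHomProperty.instIsZariskiLocalAtSource (Q := RingHom.FiniteType)
  have : LocallyOfFiniteType p := IsZariskiLocalAtSource.sigmaDesc fun _ ↦ inferInstance
  let Y : Over (Spec (.of k)) := Over.mk (p ≫ X.hom)
  have : IsAffine Y.left := inferInstanceAs (IsAffine (∐ 𝒰.X))
  have : LocallyOfFiniteType Y.hom := inferInstanceAs (LocallyOfFiniteType (p ≫ X.hom))
  have := finiteType_globalFunctions Y
  exact etale_maxEtaleSubalgebra (globalFunctionsMap (Over.homMk p : Y ⟶ X))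
    (app_sigmaDesc_injective 𝒰 ⊤)

theorem etale_piZero_hom : Etale (piZero X).hom :=
  HasRingHomProperty.Spec_iff.mpr
    (RingHom.etale_algebraMap.mpr (etale_maxEtaleSubalgebra_globalFunctions X))

theorem isFinite_piZero_hom : IsFinite (piZero X).hom := by
  have := etale_maxEtaleSubalgebra_globalFunctions X
  exact (IsFinite.SpecMap_iff _).mpr (RingHom.finite_algebraMap.mpr
    (Algebra.FormallyUnramified.finite_of_free k _))

theorem quasiCompact_toPiZero_left : QuasiCompact (toPiZero X).left := by
  have : QuasiCompact ((toPiZero X).left ≫ (piZero X).hom) := by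
    rw [Over.w]
    infer_instance
  have := isFinite_piZero_hom X
  exact .of_comp _ (piZero X).hom

theorem flat_toPiZero_left : Flat (toPiZero X).left := by
  have : Flat ((toPiZero X).left ≫ (piZero X).hom) := by
    rw [Over.w]
    infer_instance
  have := etale_piZero_hom X
  exact flat_of_flat_comp _ (piZero X).hom

theorem connectedSpace_of_isPullback_toPiZero {K : Type u} [Field K]
    [Algebra (maxEtaleSubalgebra k (GlobalFunctions X)) K] {Y : Scheme.{u}} {g : Y ⟶ X.left}
    {p : Y ⟶ Spec (.of K)}
    (H : IsPullback g p (toPiZero X).left (Spec.map (CommRingCat.ofHom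
      (algebraMap (maxEtaleSubalgebra k (GlobalFunctions X)) K)))) :
    ConnectedSpace Y := by
  let P := maxEtaleSubalgebra k (GlobalFunctions X)
  have : Algebra.Etale k P := etale_maxEtaleSubalgebra_globalFunctions X
  have : CompactSpace X.left := QuasiCompact.compactSpace_of_compactSpace X.hom
  have : IsLocallyNoetherian X.left := LocallyOfFiniteType.isLocallyNoetherian X.hom
  let : Algebra k K := ((algebraMap P K).comp (algebraMap k P)).toAlgebra
  have : IsScalarTower k P K := .of_algebraMap_eq' rfl
  have : Module.Flat P K := Algebra.FormallyUnramified.flat_of_restrictScalars k P K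
  have isPushout : IsPushout (piZeroInclusion X) (CommRingCat.ofHom (algebraMap P K)) g.appTop
      ((Scheme.ΓSpecIso (.of K)).inv ≫ p.appTop) :=
    isPushout_of_isPullback_toSpecΓ_comp (RingHom.flat_algebraMap_iff.mpr this) H
  let ψ : K ⊗[P] GlobalFunctions X ≃+* Γ(Y, ⊤) :=
    ((CommRingCat.isPushout_tensorProduct P K (GlobalFunctions X)).flip.isoIsPushout _ _
      isPushout).commRingCatIsoToRingEquiv
  have injective_algebraMap : Function.Injective (algebraMap K (K ⊗[P] GlobalFunctions X)) :=
    Algebra.TensorProduct.includeLeft_injective (S := K) Subtype.val_injective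
  have : Nontrivial Γ(Y, ⊤) := (ψ.injective.comp injective_algebraMap).nontrivial
  refine connectedSpace_of_isIdempotentElem fun e he ↦ ?_
  obtain ⟨x, hx⟩ := exists_algebraMap_eq_of_isIdempotentElem k (P := P) (K := K)
    (fun _ ↦ exists_map_maxEtaleSubalgebra_val_eq_of_isIdempotentElem) (he.map ψ.symm)
  have isIdempotentElem_x : IsIdempotentElem x :=
    injective_algebraMap (by rw [map_mul, hx, (he.map ψ.symm).eq])
  rw [← ψ.apply_symm_apply e, ← hx]
  rcases IsIdempotentElem.iff_eq_zero_or_one.mp isIdempotentElem_x with rfl | rfl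
  · exact .inl (by rw [map_zero, map_zero])
  · exact .inr (by rw [map_one, map_one])

theorem geometricallyConnected_toPiZero_left : GeometricallyConnected (toPiZero X).left :=
  ⟨(geometrically_iff_of_commRing_of_isClosedUnderIsomorphisms
    (R := maxEtaleSubalgebra k (GlobalFunctions X))).mpr
      fun _ _ _ ↦ connectedSpace_of_isPullback_toPiZero X (.of_hasPullback _ _)⟩

end PiZero

section RigidityOfEtaleTargets

variable {S : Scheme.{u}}

theorem isOpenImmersion_equalizer_ι_left {X Y : Over S} [FormallyUnramified Y.hom]
    [LocallyOfFiniteType Y.hom] (f g : X ⟶ Y) : IsOpenImmersion (equalizer.ι f g).left := by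
  refine MorphismProperty.of_isPullback
    ((isPullback_equalizer_prod f g).map (Over.forget _)).flip ?_
  change IsOpenImmersion (prod.lift (𝟙 Y) (𝟙 Y)).left
  rw [← MorphismProperty.cancel_right_of_respectsIso @IsOpenImmersion _
    (Over.prodLeftIsoPullback Y Y).hom]
  convert! (inferInstance : IsOpenImmersion (pullback.diagonal Y.hom))
  · ext1 <;> simp only [Category.assoc, Over.prodLeftIsoPullback_hom_fst,
      Over.prodLeftIsoPullback_hom_snd, ← Over.comp_left, prod.lift_fst, prod.lift_snd,
      pullback.diagonal_fst, pullback.diagonal_snd, Over.id_left]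

theorem eq_of_comp_eq_of_isPreconnected {D X Y : Over S} [FormallyUnramified Y.hom]
    [LocallyOfFiniteType Y.hom] [IsSeparated Y.hom] {f g : X ⟶ Y} (q : D ⟶ X)
    (hq : q ≫ f = q ≫ g) (exists_isPreconnected : ∀ x : X.left, ∃ T : Set X.left,
      _root_.IsPreconnected T ∧ x ∈ T ∧ (T ∩ Set.range q.left).Nonempty) : f = g := by
  let ι := equalizer.ι f g
  have : IsOpenImmersion ι.left := isOpenImmersion_equalizer_ι_left f g
  have isClopen_range : IsClopen (Set.range ι.left) :=
    ⟨ι.left.isClosedEmbedding.isClosed_range, ι.left.isOpenEmbedding.isOpen_range⟩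
  have range_subset : Set.range q.left ⊆ Set.range ι.left := by
    rintro _ ⟨d, rfl⟩
    exact ⟨(equalizer.lift q hq).left d,
      by rw [← Scheme.Hom.comp_apply, ← Over.comp_left, equalizer.lift_ι]⟩
  have : Surjective ι.left := ⟨fun x ↦ by
    obtain ⟨T, hT, mem_T, nonempty⟩ := exists_isPreconnected x
    exact hT.subset_isClopen isClopen_range
      (nonempty.mono (Set.inter_subset_inter_right T range_subset)) mem_T⟩
  have : IsIso ι.left := (isIso_iff_isOpenImmersion_and_surjective ι.left).mpr ⟨‹_›, ‹_›⟩
  ext1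
  rw [← cancel_epi ι.left]
  exact congr($(equalizer.condition f g).left)

theorem locallyQuasiFinite_of_formallyUnramified {X Y : Scheme.{u}} (f : X ⟶ Y)
    [FormallyUnramified f] [LocallyOfFiniteType f] : LocallyQuasiFinite f := by
  refine HasRingHomProperty.iff_appLE.mpr fun U V e ↦ ?_
  have h₁ := (HasRingHomProperty.iff_appLE (P := @FormallyUnramified)).mp ‹_› U V e
  have h₂ := (HasRingHomProperty.iff_appLE (P := @LocallyOfFiniteType)).mp ‹_› U V e
  algebraize [(f.appLE U V e).hom]
  exact inferInstanceAs (Algebra.QuasiFinite _ _)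

variable {k : Type u} [Field k]

theorem discreteTopology_of_etale {X : Scheme.{u}} (f : X ⟶ Spec (.of k)) [Etale f] :
    DiscreteTopology X := by
  have := locallyQuasiFinite_of_formallyUnramified f
  have : IsLocallyArtinian X := .of_locallyQuasiFinite f
  infer_instance

theorem isSeparated_of_etale {X : Scheme.{u}} (f : X ⟶ Spec (.of k)) [Etale f] :
    IsSeparated f := by
  have : DiscreteTopology ↥(pullback f f) :=
    discreteTopology_of_etale (pullback.fst f f ≫ f)
  exact ⟨.of_isPreimmersion _ (isClosed_discrete _)⟩

end RigidityOfEtaleTargets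

section CartesianMonoidal

open CartesianMonoidalCategory

variable {C : Type*} [Category* C] [CartesianMonoidalCategory C] {X Y : C}

theorem isPullback_whiskerRight_fst (f : X ⟶ Y) (Z : C) :
    IsPullback (f ▷ Z) (fst X Z) (fst Y Z) f where
  w := whiskerRight_fst f Z
  isLimit' := ⟨PullbackCone.IsLimit.mk _ (fun s ↦ lift s.snd (s.fst ≫ snd Y Z))
    (fun s ↦ by ext <;> simp [s.condition]) (fun s ↦ by simp)
    fun s m h₁ h₂ ↦ by ext <;> simp [← h₁, ← h₂]⟩

theorem isPullback_whiskerLeft_snd (Z : C) (f : X ⟶ Y) :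
    IsPullback (Z ◁ f) (snd Z X) (snd Z Y) f where
  w := whiskerLeft_snd Z f
  isLimit' := ⟨PullbackCone.IsLimit.mk _ (fun s ↦ lift (s.fst ≫ fst Z Y) s.snd)
    (fun s ↦ by ext <;> simp [s.condition]) (fun s ↦ by simp)
    fun s m h₁ h₂ ↦ by ext <;> simp [← h₁, ← h₂]⟩

end CartesianMonoidal

section PullbackAlongToPiZero

theorem bijective_comp_of_geometricallyConnected {S : Scheme.{u}} {X Y H : Over S} (p : X ⟶ Y)
    [Flat p.left] [QuasiCompact p.left] [GeometricallyConnected p.left]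
    [FormallyUnramified H.hom] [LocallyOfFiniteType H.hom] [IsSeparated H.hom] :
    Function.Bijective fun f : Y ⟶ H ↦ p ≫ f := by
  refine ⟨fun f g hfg ↦ ?_, fun f ↦ ?_⟩
  · ext : 1
    rw [← cancel_epi p.left]
    exact congr($(hfg).left)
  have isKernelPair : IsKernelPair p.left (pullback.fst p p).left (pullback.snd p p).left :=
    (IsPullback.of_hasPullback p p).map (Over.forget S)
  have fst_comp_eq : pullback.fst p p ≫ f = pullback.snd p p ≫ f := by
    refine eq_of_comp_eq_of_isPreconnected (pullback.diagonal p) (by simp) fun y ↦ ?_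
    have : GeometricallyConnected (pullback.fst p p).left :=
      MorphismProperty.of_isPullback isKernelPair.flip ‹_›
    refine ⟨_, ((pullback.fst p p).left.isConnected_preimage_singleton
      ((pullback.fst p p).left y)).isPreconnected, rfl,
      (pullback.diagonal p).left ((pullback.fst p p).left y), ?_, ⟨_, rfl⟩⟩
    rw [Set.mem_preimage, ← Scheme.Hom.comp_apply, ← Over.comp_left, pullback.diagonal_fst]
    rfl
  obtain ⟨d, hd⟩ := IsRegularEpi.exists_of_isKernelPair p.left isKernelPair f.left
    congr($(fst_comp_eq).left)
  refine ⟨Over.homMk d ?_, by ext : 1; exact hd⟩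
  rw [← cancel_epi p.left, reassoc_of% hd, Over.w, Over.w]

variable {k : Type u} [Field k] (X : Over (Spec (.of k))) [LocallyOfFiniteType X.hom]
  [QuasiCompact X.hom] (H : Over (Spec (.of k))) [Etale H.hom]

theorem bijective_toPiZero_whiskerRight_comp (S : Over (Spec (.of k))) :
    Function.Bijective fun f : piZero X ⊗ S ⟶ H ↦ (toPiZero X ▷ S) ≫ f := by
  have isPullback := ((isPullback_whiskerRight_fst (toPiZero X) S).map (Over.forget _)).flip
  have : Flat (toPiZero X ▷ S).left :=
    MorphismProperty.of_isPullback isPullback (flat_toPiZero_left X)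
  have : QuasiCompact (toPiZero X ▷ S).left :=
    MorphismProperty.of_isPullback isPullback (quasiCompact_toPiZero_left X)
  have : GeometricallyConnected (toPiZero X ▷ S).left :=
    MorphismProperty.of_isPullback isPullback (geometricallyConnected_toPiZero_left X)
  have := isSeparated_of_etale H.hom
  exact bijective_comp_of_geometricallyConnected (toPiZero X ▷ S)

theorem isIso_homFunctorPullback_toPiZero [GrpObj H] :
    IsIso (homFunctorPullback (toPiZero X) H) := by
  have (S : (Over (Spec (.of k)))ᵒᵖ) : IsIso ((homFunctorPullback (toPiZero X) H).app S) :=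
    (ConcreteCategory.isIso_iff_bijective _).mpr
      (bijective_toPiZero_whiskerRight_comp X H S.unop)
  exact NatIso.isIso_of_isIso_app _

end PullbackAlongToPiZero

section WeilRestriction

theorem isNilpotent_ker_map_mkₐ {k : Type*} [CommRing k] (A : Type*) [CommRing A] [Algebra k A]
    {C : Type*} [CommRing C] [Algebra k C] {I : Ideal C} (hI : IsNilpotent I) :
    IsNilpotent (RingHom.ker (Algebra.TensorProduct.map (AlgHom.id k A)
      (Ideal.Quotient.mkₐ k I) : A ⊗[k] C →+* A ⊗[k] (C ⧸ I))) := by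
  obtain ⟨n, hn⟩ := hI
  have ker_mkₐ : RingHom.ker (Ideal.Quotient.mkₐ k I) = I := Ideal.Quotient.mkₐ_ker k I
  have ker_map := Algebra.TensorProduct.lTensor_ker (A := A) (Ideal.Quotient.mkₐ k I)
    (Ideal.Quotient.mkₐ_surjective k I)
  rw [ker_mkₐ] at ker_map
  refine ⟨n, (congrArg (· ^ n) ker_map).trans ?_⟩
  rw [← Ideal.map_pow, hn, Ideal.zero_eq_bot, Ideal.map_bot, Ideal.zero_eq_bot]

variable {k A ι : Type*} [CommRing k] [CommRing A] [Algebra k A] [DecidableEq ι]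
  (b : Module.Basis ι k A)

theorem equivFinsuppOfBasisLeft_map {C D : Type*} [CommRing C] [CommRing D] [Algebra k C]
    [Algebra k D] (φ : C →ₐ[k] D) (z : A ⊗[k] C) (i : ι) :
    TensorProduct.equivFinsuppOfBasisLeft b
      (Algebra.TensorProduct.map (AlgHom.id k A) φ z) i =
      φ (TensorProduct.equivFinsuppOfBasisLeft b z i) :=
  equivFinsuppOfBasisLeft_lTensor b φ.toLinearMap z i

theorem ext_equivFinsuppOfBasisLeft {C : Type*} [CommRing C] [Algebra k C] {z w : A ⊗[k] C}
    (h : ∀ i, TensorProduct.equivFinsuppOfBasisLeft b z i =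
      TensorProduct.equivFinsuppOfBasisLeft b w i) : z = w :=
  (TensorProduct.equivFinsuppOfBasisLeft b).injective (Finsupp.ext h)

theorem mem_range_map_val_iff [Finite ι] {C : Type*} [CommRing C] [Algebra k C]
    (C₀ : Subalgebra k C) (z : A ⊗[k] C) :
    z ∈ (Algebra.TensorProduct.map (AlgHom.id k A) C₀.val).range ↔
      ∀ i, TensorProduct.equivFinsuppOfBasisLeft b z i ∈ C₀ := by
  constructor
  · rintro ⟨w, rfl⟩ i
    exact (congrArg (· ∈ C₀) (equivFinsuppOfBasisLeft_map b C₀.val w i)).mpr (Subtype.property _)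
  · intro h
    refine ⟨(TensorProduct.equivFinsuppOfBasisLeft b).symm
      (Finsupp.equivFunOnFinite.symm fun i ↦ ⟨_, h i⟩), ext_equivFinsuppOfBasisLeft b fun i ↦ ?_⟩
    refine (equivFinsuppOfBasisLeft_map b C₀.val _ i).trans ?_
    rw [LinearEquiv.apply_symm_apply]
    rfl

variable [Finite ι] (B : Type*) [CommRing B] [Algebra k B]

/-- The element `∑ i, b i ⊗ X (x, i)`, which a homomorphism `B →ₐ[k] A ⊗[k] C` specializes to the
image of `x` once the indeterminates are replaced by the coordinates of that image. -/
def genericElement (x : B) : A ⊗[k] MvPolynomial (B × ι) k :=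
  (TensorProduct.equivFinsuppOfBasisLeft b).symm
    (Finsupp.equivFunOnFinite.symm fun i ↦ MvPolynomial.X (x, i))

variable {B} in
/-- The elements of `A ⊗[k] k[B × ι]` that have to vanish for `genericElement` to become a
homomorphism of `k`-algebras. -/
inductive GenericRelation : A ⊗[k] MvPolynomial (B × ι) k → Prop
  | add (x y : B) : GenericRelation
      (genericElement b B (x + y) - (genericElement b B x + genericElement b B y))
  | mul (x y : B) : GenericRelation
      (genericElement b B (x * y) - genericElement b B x * genericElement b B y)
  | algebraMap (c : k) : GenericRelation
      (genericElement b B (algebraMap k B c) - algebraMap k _ c)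

/-- The ideal of `k[B × ι]` that cuts out the Weil restriction. -/
def weilRestrictionIdeal : Ideal (MvPolynomial (B × ι) k) :=
  .span {p | ∃ z, GenericRelation b z ∧ ∃ i, TensorProduct.equivFinsuppOfBasisLeft b z i = p}

/-- The `k`-algebra of the Weil restriction along `A` of `Spec (A ⊗[k] B)`, where `A` is a
`k`-algebra with a finite basis `b`: it represents `C ↦ (B →ₐ[k] A ⊗[k] C)`. -/
abbrev WeilRestriction : Type _ :=
  MvPolynomial (B × ι) k ⧸ weilRestrictionIdeal b B

theorem map_mkₐ_eq_zero_of_genericRelation {z : A ⊗[k] MvPolynomial (B × ι) k}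
    (hz : GenericRelation b z) :
    Algebra.TensorProduct.map (AlgHom.id k A)
      (Ideal.Quotient.mkₐ k (weilRestrictionIdeal b B)) z = 0 :=
  ext_equivFinsuppOfBasisLeft b fun i ↦ by
    rw [equivFinsuppOfBasisLeft_map, map_zero, Finsupp.zero_apply, Ideal.Quotient.mkₐ_eq_mk,
      Ideal.Quotient.eq_zero_iff_mem]
    exact Ideal.subset_span ⟨z, hz, i, rfl⟩

/-- The universal homomorphism, from which every `B →ₐ[k] A ⊗[k] C` arises by a unique base change
along a homomorphism `WeilRestriction b B →ₐ[k] C`. -/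
def weilRestrictionHom : B →ₐ[k] A ⊗[k] WeilRestriction b B :=
  let μ := Algebra.TensorProduct.map (AlgHom.id k A)
    (Ideal.Quotient.mkₐ k (weilRestrictionIdeal b B))
  have map_algebraMap (c : k) :
      μ (genericElement b B (algebraMap k B c)) = algebraMap k (A ⊗[k] WeilRestriction b B) c := by
    have h := map_mkₐ_eq_zero_of_genericRelation b B (.algebraMap c)
    rwa [map_sub, sub_eq_zero, AlgHom.commutes] at h
  { toFun := fun x ↦ μ (genericElement b B x)
    map_add' := fun x y ↦ by
      rw [← map_add, ← sub_eq_zero, ← map_sub]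
      exact map_mkₐ_eq_zero_of_genericRelation b B (.add x y)
    map_mul' := fun x y ↦ by
      rw [← map_mul, ← sub_eq_zero, ← map_sub]
      exact map_mkₐ_eq_zero_of_genericRelation b B (.mul x y)
    map_zero' := by simpa only [map_zero] using map_algebraMap 0
    map_one' := by simpa only [map_one] using map_algebraMap 1
    commutes' := map_algebraMap }

theorem equivFinsuppOfBasisLeft_weilRestrictionHom (x : B) (i : ι) :
    TensorProduct.equivFinsuppOfBasisLeft b (weilRestrictionHom b B x) i =
      Ideal.Quotient.mkₐ k (weilRestrictionIdeal b B) (MvPolynomial.X (x, i)) := by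
  change TensorProduct.equivFinsuppOfBasisLeft b
    (Algebra.TensorProduct.map _ _ (genericElement b B x)) i = _
  rw [equivFinsuppOfBasisLeft_map, genericElement, LinearEquiv.apply_symm_apply]
  rfl

variable {B} in
theorem exists_map_comp_weilRestrictionHom_eq {C : Type*} [CommRing C] [Algebra k C]
    (θ : B →ₐ[k] A ⊗[k] C) : ∃ φ : WeilRestriction b B →ₐ[k] C,
      (Algebra.TensorProduct.map (AlgHom.id k A) φ).comp (weilRestrictionHom b B) = θ := by
  let φ₀ : MvPolynomial (B × ι) k →ₐ[k] C :=
    MvPolynomial.aeval fun xi ↦ TensorProduct.equivFinsuppOfBasisLeft b (θ xi.1) xi.2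
  have map_genericElement (x : B) :
      Algebra.TensorProduct.map (AlgHom.id k A) φ₀ (genericElement b B x) = θ x :=
    ext_equivFinsuppOfBasisLeft b fun i ↦ by
      rw [equivFinsuppOfBasisLeft_map, genericElement, LinearEquiv.apply_symm_apply]
      exact MvPolynomial.aeval_X _ _
  have le_ker : weilRestrictionIdeal b B ≤ RingHom.ker φ₀ := by
    refine Ideal.span_le.mpr ?_
    rintro _ ⟨z, hz, i, rfl⟩
    rw [SetLike.mem_coe, RingHom.mem_ker, ← equivFinsuppOfBasisLeft_map]
    cases hz <;> simp [map_genericElement]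
  refine ⟨Ideal.Quotient.liftₐ _ φ₀ fun p hp ↦ le_ker hp,
    AlgHom.ext fun x ↦ ext_equivFinsuppOfBasisLeft b fun i ↦ ?_⟩
  rw [AlgHom.comp_apply, equivFinsuppOfBasisLeft_map, equivFinsuppOfBasisLeft_weilRestrictionHom]
  exact MvPolynomial.aeval_X
    (fun xi : B × ι ↦ TensorProduct.equivFinsuppOfBasisLeft b (θ xi.1) xi.2) (x, i)

theorem bijective_map_comp_weilRestrictionHom (C : Type*) [CommRing C] [Algebra k C] :
    Function.Bijective fun φ : WeilRestriction b B →ₐ[k] C ↦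
      (Algebra.TensorProduct.map (AlgHom.id k A) φ).comp (weilRestrictionHom b B) := by
  refine ⟨fun φ ψ h ↦ ?_, exists_map_comp_weilRestrictionHom_eq b⟩
  refine Ideal.Quotient.algHom_ext k (MvPolynomial.algHom_ext fun xi ↦ ?_)
  have := DFunLike.congr_fun (congrArg (TensorProduct.equivFinsuppOfBasisLeft b)
    (DFunLike.congr_fun h xi.1)) xi.2
  simpa only [AlgHom.comp_apply, equivFinsuppOfBasisLeft_map,
    equivFinsuppOfBasisLeft_weilRestrictionHom] using this

instance finiteType_weilRestriction [Algebra.FiniteType k B] :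
    Algebra.FiniteType k (WeilRestriction b B) := by
  obtain ⟨s, hs⟩ := ‹Algebra.FiniteType k B›.out
  let coordinate (x : B) (i : ι) : WeilRestriction b B :=
    TensorProduct.equivFinsuppOfBasisLeft b (weilRestrictionHom b B x) i
  let R₀ : Subalgebra k (WeilRestriction b B) :=
    Algebra.adjoin k (Set.range fun xi : s × ι ↦ coordinate xi.1 xi.2)
  have coordinate_mem (x : B) (i : ι) : coordinate x i ∈ R₀ := by
    have hle : Algebra.adjoin k (s : Set B) ≤
        (Algebra.TensorProduct.map (AlgHom.id k A) R₀.val).range.comap (weilRestrictionHom b B) :=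
      Algebra.adjoin_le fun x hx ↦ (mem_range_map_val_iff b R₀ _).mpr fun i ↦
        Algebra.subset_adjoin ⟨(⟨x, hx⟩, i), rfl⟩
    exact (mem_range_map_val_iff b R₀ _).mp (hle (hs ▸ Algebra.mem_top)) i
  have eq_top : R₀ = ⊤ := by
    refine eq_top_iff.mpr fun r _ ↦ ?_
    obtain ⟨p, rfl⟩ := Ideal.Quotient.mkₐ_surjective k (weilRestrictionIdeal b B) r
    induction p using MvPolynomial.induction_on with
    | C c => exact Subalgebra.algebraMap_mem _ c
    | add p q hp hq => rw [map_add]; exact add_mem (hp trivial) (hq trivial)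
    | mul_X p xi hp =>
      rw [map_mul, ← equivFinsuppOfBasisLeft_weilRestrictionHom]
      exact mul_mem (hp trivial) (coordinate_mem _ _)
  exact ⟨Subalgebra.fg_def.mpr ⟨_, Set.finite_range _, eq_top⟩⟩

instance formallyEtale_weilRestriction [Algebra.FormallyEtale k B] :
    Algebra.FormallyEtale k (WeilRestriction b B) := by
  refine Algebra.FormallyEtale.iff_comp_bijective.mpr fun C _ _ I hI ↦ ?_
  let π := Ideal.Quotient.mkₐ k I
  let g := Algebra.TensorProduct.map (AlgHom.id k A) π
  have surjective_g : Function.Surjective g :=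
    LinearMap.lTensor_surjective A (g := π.toLinearMap) (Ideal.Quotient.mkₐ_surjective k I)
  have isNilpotent_ker : IsNilpotent (RingHom.ker (g : A ⊗[k] C →+* A ⊗[k] (C ⧸ I))) :=
    isNilpotent_ker_map_mkₐ A ⟨2, hI⟩
  have map_comp (φ : WeilRestriction b B →ₐ[k] C) :
      (Algebra.TensorProduct.map (AlgHom.id k A) (π.comp φ)).comp (weilRestrictionHom b B) =
        g.comp ((Algebra.TensorProduct.map (AlgHom.id k A) φ).comp (weilRestrictionHom b B)) := by
    rw [← AlgHom.comp_assoc, ← Algebra.TensorProduct.map_comp, AlgHom.id_comp]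
  constructor
  · intro φ ψ h
    refine (bijective_map_comp_weilRestrictionHom b B C).1
      (Algebra.FormallyUnramified.lift_unique' g isNilpotent_ker _ _ ?_)
    rw [← map_comp, ← map_comp]
    exact congrArg
      (fun χ ↦ (Algebra.TensorProduct.map (AlgHom.id k A) χ).comp (weilRestrictionHom b B)) h
  · intro ψ
    obtain ⟨φ, hφ⟩ := exists_map_comp_weilRestrictionHom_eq b
      (Algebra.FormallySmooth.liftOfSurjective ((Algebra.TensorProduct.map (AlgHom.id k A) ψ).comp
        (weilRestrictionHom b B)) g surjective_g isNilpotent_ker)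
    refine ⟨φ, (bijective_map_comp_weilRestrictionHom b B (C ⧸ I)).1 ?_⟩
    beta_reduce
    rw [map_comp, hφ, Algebra.FormallySmooth.comp_liftOfSurjective]

end WeilRestriction

section ZariskiGluing

variable {S : Scheme.{u}}

instance isOpenImmersion_whiskerLeft_left (E : Over S) {X Y : Over S} (j : X ⟶ Y)
    [IsOpenImmersion j.left] : IsOpenImmersion (E ◁ j).left :=
  MorphismProperty.of_isPullback (P := @IsOpenImmersion)
    ((isPullback_whiskerLeft_snd E j).map (Over.forget _)).flip ‹_›

variable {X Y : Over S} {ι : Type u} {U : ι → Over S} (j : ∀ i, U i ⟶ X)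
  [∀ i, IsOpenImmersion (j i).left] (covers : ∀ x, ∃ i y, (j i).left y = x)

include covers

theorem hom_ext_of_covers {f g : X ⟶ Y} (h : ∀ i, j i ≫ f = j i ≫ g) : f = g := by
  let 𝒰 : X.left.OpenCover := .mkOfCovers ι _ (fun i ↦ (j i).left) covers
  exact Over.OverMorphism.ext (𝒰.hom_ext _ _ fun i ↦ congrArg (·.left) (h i))

theorem exists_comp_eq_of_covers (f : ∀ i, U i ⟶ Y)
    (compatible : ∀ i i' (T : Over S) (a : T ⟶ U i) (b : T ⟶ U i'),
      a ≫ j i = b ≫ j i' → a ≫ f i = b ≫ f i') : ∃ g : X ⟶ Y, ∀ i, j i ≫ g = f i := by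
  let 𝒰 : X.left.OpenCover := .mkOfCovers ι _ (fun i ↦ (j i).left) covers
  let g : X.left ⟶ Y.left := 𝒰.glueMorphisms (fun i ↦ (f i).left) fun (i i' : ι) ↦ by
    let p := pullback.fst (j i).left (j i').left
    let q := pullback.snd (j i).left (j i').left
    have hpq : p ≫ (j i).left = q ≫ (j i').left := pullback.condition
    let a : Over.mk (p ≫ (U i).hom) ⟶ U i := Over.homMk p
    let b : Over.mk (p ≫ (U i).hom) ⟶ U i' := Over.homMk q <| by
      rw [← Over.w (j i), ← Over.w (j i'), reassoc_of% hpq]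
      rfl
    exact congrArg (·.left) (compatible i i' _ a b (Over.OverMorphism.ext hpq))
  have hg (i : ι) : (j i).left ≫ g = (f i).left := Scheme.Cover.ι_glueMorphisms 𝒰 _ _ i
  refine ⟨Over.homMk g (𝒰.hom_ext _ _ fun i ↦ ?_), fun i ↦ Over.OverMorphism.ext (hg i)⟩
  change (j i).left ≫ g ≫ Y.hom = (j i).left ≫ X.hom
  rw [reassoc_of% hg i, Over.w, Over.w]

omit [∀ i, IsOpenImmersion (j i).left] in
theorem exists_whiskerLeft_left_eq (E : Over S) (x : (E ⊗ X).left) :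
    ∃ i y, (E ◁ j i).left y = x := by
  obtain ⟨i, y, hy⟩ := covers ((CartesianMonoidalCategory.snd E X).left x)
  obtain ⟨z, hz, -⟩ := Scheme.exists_preimage_of_isPullback
    ((isPullback_whiskerLeft_snd E (j i)).map (Over.forget _)) x y hy.symm
  exact ⟨i, z, hz⟩

end ZariskiGluing

section IsUniversal

/-- The morphism `u : E ⊗ N ⟶ H` exhibits `N` as the internal Hom from `E` to `H`, that is, as an
object representing the functor `T ↦ (E ⊗ T ⟶ H)`. -/
def IsUniversal {C : Type*} [Category* C] [MonoidalCategory C] {E N H : C} (u : E ⊗ N ⟶ H) :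
    Prop :=
  ∀ T, Function.Bijective fun a : T ⟶ N ↦ (E ◁ a) ≫ u

section Monoidal

variable {C D : Type*} [Category* C] [MonoidalCategory C] [Category* D] [MonoidalCategory D]
  {E N H : C} {u : E ⊗ N ⟶ H}

theorem IsUniversal.comp_iso {H' : C} (hu : IsUniversal u) (e : H ≅ H') :
    IsUniversal (u ≫ e.hom) := fun T ↦ by
  have h := (Iso.homToEquiv e (Z := E ⊗ T)).bijective.comp (hu T)
  simpa only [Function.comp_def, Iso.homToEquiv_apply, Category.assoc] using h

theorem IsUniversal.iso_comp {E' : C} (hu : IsUniversal u) (e : E' ≅ E) :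
    IsUniversal ((e.hom ▷ N) ≫ u) := fun T ↦ by
  have h := (whiskerRightIso e.symm T).homFromEquiv.bijective.comp (hu T)
  simpa [Function.comp_def, whisker_exchange_assoc] using h

theorem bijective_whiskerLeft_comp_of_iso {T T' : C} (e : T ≅ T')
    (h : Function.Bijective fun a : T' ⟶ N ↦ (E ◁ a) ≫ u) :
    Function.Bijective fun a : T ⟶ N ↦ (E ◁ a) ≫ u := by
  have h' := ((whiskerLeftIso E e.symm).homFromEquiv.bijective.comp h).comp
    e.homFromEquiv.bijective
  simpa [Function.comp_def] using h'

theorem IsUniversal.bijective_of_mem_essImage (hu : IsUniversal u) (F : C ⥤ D) [F.Monoidal]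
    [F.Full] [F.Faithful] {T : D} (hT : F.essImage T) :
    Function.Bijective fun a : T ⟶ F.obj N ↦
      (F.obj E ◁ a) ≫ Functor.LaxMonoidal.μ F E N ≫ F.map u := by
  obtain ⟨T', ⟨e⟩⟩ := hT
  let F' := Functor.FullyFaithful.ofFullyFaithful F
  refine bijective_whiskerLeft_comp_of_iso e.symm ?_
  have h := (Functor.Monoidal.μIso F E T').symm.homFromEquiv.bijective.comp
    ((F'.homEquiv.bijective.comp (hu T')).comp F'.homEquiv.symm.bijective)
  convert h using 1
  funext a
  obtain ⟨a, rfl⟩ := F.map_surjective a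
  change _ = Functor.LaxMonoidal.μ F E T' ≫ F.map ((E ◁ F.preimage (F.map a)) ≫ u)
  rw [F.preimage_map, F.map_comp, Functor.LaxMonoidal.μ_natural_right_assoc]

end Monoidal

variable {S : Scheme.{u}}

/-- The restriction of an `S`-scheme to an open subset. -/
def restrictOver (X : Over S) (V : X.left.Opens) : Over S :=
  Over.mk (V.ι ≫ X.hom)

/-- The inclusion of an open subscheme of an `S`-scheme. -/
def restrictOverι (X : Over S) (V : X.left.Opens) : restrictOver X V ⟶ X :=
  Over.homMk V.ι

instance isOpenImmersion_restrictOverι_left (X : Over S) (V : X.left.Opens) :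
    IsOpenImmersion (restrictOverι X V).left :=
  inferInstanceAs (IsOpenImmersion V.ι)

theorem isUniversal_of_local {E N H : Over S} (u : E ⊗ N ⟶ H)
    (inj : ∀ (T : Over S) (a b : T ⟶ N), (E ◁ a) ≫ u = (E ◁ b) ≫ u →
      ∀ t : T.left, ∃ V : T.left.Opens, t ∈ V ∧ restrictOverι T V ≫ a = restrictOverι T V ≫ b)
    (surj : ∀ (T : Over S) (f : E ⊗ T ⟶ H) (t : T.left), ∃ V : T.left.Opens, t ∈ V ∧
      ∃ a : restrictOver T V ⟶ N, (E ◁ a) ≫ u = (E ◁ restrictOverι T V) ≫ f) :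
    IsUniversal u := by
  have covers {T : Over S} {V : T.left → T.left.Opens} (hV : ∀ t, t ∈ V t) (t : T.left) :
      ∃ t' v, (restrictOverι T (V t')).left v = t := ⟨t, ⟨t, hV t⟩, rfl⟩
  have injective (T : Over S) (a b : T ⟶ N) (hab : (E ◁ a) ≫ u = (E ◁ b) ≫ u) : a = b := by
    choose V hV h using inj T a b hab
    exact hom_ext_of_covers (fun t ↦ restrictOverι T (V t)) (covers hV) h
  refine fun T ↦ ⟨fun a b ↦ injective T a b, fun f ↦ ?_⟩
  choose V hV a ha using surj T f
  obtain ⟨g, hg⟩ := exists_comp_eq_of_covers (fun t ↦ restrictOverι T (V t)) (covers hV) a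
    fun t t' T' p q hpq ↦ injective T' _ _ <| by
      rw [whiskerLeft_comp_assoc, whiskerLeft_comp_assoc, ha, ha, ← whiskerLeft_comp_assoc, hpq,
        whiskerLeft_comp_assoc]
  refine ⟨g, hom_ext_of_covers (fun t ↦ E ◁ restrictOverι T (V t))
    (exists_whiskerLeft_left_eq _ (covers hV) E) fun t ↦ ?_⟩
  rw [← whiskerLeft_comp_assoc, hg, ha]

end IsUniversal

section Affine

variable {R : CommRingCat.{u}}

theorem isUniversal_of_isAffine {E N H : Over (Spec R)} (u : E ⊗ N ⟶ H)
    (bijective : ∀ (T : Over (Spec R)) [IsAffine T.left],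
      Function.Bijective fun a : T ⟶ N ↦ (E ◁ a) ≫ u) : IsUniversal u := by
  have exists_affine {T : Scheme.{u}} (t : T) : ∃ V : T.Opens, t ∈ V ∧ IsAffineOpen V := by
    obtain ⟨V, hV, ht, -⟩ := exists_isAffineOpen_mem_and_subset (x := t) (U := ⊤) trivial
    exact ⟨V, ht, hV⟩
  refine isUniversal_of_local _ (fun T a b hab t ↦ ?_) fun T f t ↦ ?_
  · obtain ⟨V, ht, hV⟩ := exists_affine t
    have : IsAffine (restrictOver T V).left := hV
    refine ⟨V, ht, (bijective (restrictOver T V)).injective ?_⟩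
    simp only [whiskerLeft_comp, Category.assoc, hab]
  · obtain ⟨V, ht, hV⟩ := exists_affine t
    have : IsAffine (restrictOver T V).left := hV
    exact ⟨V, ht, (bijective (restrictOver T V)).surjective _⟩

theorem IsUniversal.map_algSpec {E N H : (CommAlgCat R)ᵒᵖ} {u : E ⊗ N ⟶ H} (hu : IsUniversal u) :
    IsUniversal (Functor.LaxMonoidal.μ (algSpec R) E N ≫ (algSpec R).map u) :=
  isUniversal_of_isAffine _ fun _ _ ↦
    hu.bijective_of_mem_essImage (algSpec R) (essImage_algSpec.mpr ‹_›)

theorem isUniversal_weilRestrictionHom {ι A : Type u} [CommRing A] [Algebra R A] [Finite ι]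
    [DecidableEq ι] (b : Module.Basis ι R A) (B : Type u) [CommRing B] [Algebra R B] :
    IsUniversal (E := op (CommAlgCat.of R A)) (N := op (CommAlgCat.of R (WeilRestriction b B)))
      (CommAlgCat.ofHom (weilRestrictionHom b B)).op := fun T ↦ by
  let homEquiv (X Y : CommAlgCat R) : (op Y ⟶ op X) ≃ (X →ₐ[R] Y) :=
    ⟨fun f ↦ f.unop.hom, fun φ ↦ (CommAlgCat.ofHom φ).op, fun _ ↦ rfl, fun _ ↦ rfl⟩
  exact (homEquiv (.of R B) (.of R A ⊗ T.unop)).symm.bijective.comp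
    ((bijective_map_comp_weilRestrictionHom b B T.unop).comp
      (homEquiv (.of R (WeilRestriction b B)) T.unop).bijective)

theorem etale_algSpec_obj_hom_iff (B : CommAlgCat R) :
    Etale ((algSpec R).obj (op B)).hom ↔ Algebra.Etale R B :=
  (HasRingHomProperty.Spec_iff (P := @Etale) (φ := CommRingCat.ofHom (algebraMap R B))).trans
    RingHom.etale_algebraMap

theorem exists_isUniversal_algSpec [IsNoetherianRing R] (A B : CommAlgCat R) [Module.Finite R A]
    [Module.Free R A] [Algebra.Etale R B] :
    ∃ (N : Over (Spec R)) (u : (algSpec R).obj (op A) ⊗ N ⟶ (algSpec R).obj (op B)),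
      IsUniversal u ∧ Etale N.hom ∧ IsAffine N.left := by
  classical
  let b := Module.Free.chooseBasis R A
  have : Algebra.Etale R (WeilRestriction b B) :=
    { finitePresentation := Algebra.FinitePresentation.of_finiteType.mp inferInstance }
  exact ⟨(algSpec R).obj (op (.of R (WeilRestriction b B))), _,
    (isUniversal_weilRestrictionHom b B).map_algSpec,
    (etale_algSpec_obj_hom_iff (.of R (WeilRestriction b B))).mpr this,
    essImage_algSpec.mp ((algSpec R).obj_mem_essImage _)⟩

theorem exists_isUniversal_of_isAffine {k : Type u} [Field k] (E H : Over (Spec (.of k)))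
    [IsFinite E.hom] [IsAffine H.left] [Etale H.hom] :
    ∃ (N : Over (Spec (.of k))) (u : E ⊗ N ⟶ H),
      IsUniversal u ∧ Etale N.hom ∧ IsAffine N.left := by
  have isIso_left {X Y : Over (Spec (.of k))} (e : X ≅ Y) : IsIso e.hom.left :=
    inferInstanceAs (IsIso ((Over.forget _).map e.hom))
  obtain ⟨⟨A⟩, ⟨eA⟩⟩ := essImage_algSpec.mpr (isAffine_of_isAffineHom E.hom)
  obtain ⟨⟨B⟩, ⟨eB⟩⟩ := essImage_algSpec.mpr ‹IsAffine H.left›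
  have : Module.Finite k A := by
    have : IsFinite ((algSpec (.of k)).obj (op A)).hom := Over.w eA.hom ▸ inferInstance
    exact RingHom.finite_algebraMap.mp ((IsFinite.SpecMap_iff _).mp this)
  have : Algebra.Etale k B := (etale_algSpec_obj_hom_iff B).mp (Over.w eB.hom ▸ inferInstance)
  obtain ⟨N, u, hu, hN⟩ := exists_isUniversal_algSpec A B
  exact ⟨N, _, (hu.iso_comp eA.symm).comp_iso eB, hN⟩

end Affine

theorem isOpen_setOf_image_preimage_singleton_eq {X Y T : Type*} [TopologicalSpace X]
    [TopologicalSpace Y] [DiscreteTopology Y] [TopologicalSpace T] {p : X → T} (hpo : IsOpenMap p)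
    (hpc : IsClosedMap p) {f : X → Y} (hf : Continuous f) {U : Set Y} (hU : U.Finite) :
    IsOpen {t | f '' (p ⁻¹' {t}) = U} := by
  have eq : {t | f '' (p ⁻¹' {t}) = U} = (p '' (f ⁻¹' Uᶜ))ᶜ ∩ ⋂ y ∈ U, p '' (f ⁻¹' {y}) := by
    ext t
    simp only [Set.mem_ofPred_eq, Set.Subset.antisymm_iff, Set.mem_inter_iff, Set.mem_iInter]
    refine and_congr ?_ (forall₂_congr fun y _ ↦ exists_congr fun x ↦ and_comm)
    rw [Set.image_subset_iff, Set.mem_compl_iff, Set.mem_image, not_exists]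
    exact forall_congr' fun x ↦ by
      simp only [Set.mem_preimage, Set.mem_singleton_iff, Set.mem_compl_iff]
      tauto
  rw [eq]
  exact (hpc _ ((isClosed_discrete _).preimage hf)).isOpen_compl.inter
    (hU.isOpen_biInter fun y _ ↦ hpo _ ((isOpen_discrete _).preimage hf))

section FiberImage

open CartesianMonoidalCategory

variable {S : Scheme.{u}}

instance mono_of_isOpenImmersion_left {X Y : Over S} (j : X ⟶ Y) [IsOpenImmersion j.left] :
    Mono j :=
  have : Mono ((Over.forget S).map j) := inferInstanceAs (Mono j.left)
  (Over.forget S).mono_of_mono_map this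

theorem exists_comp_eq_of_forall_mem_range {X Y T : Over S} (j : X ⟶ Y) [IsOpenImmersion j.left]
    (a : T ⟶ Y) (h : ∀ t, a.left t ∈ Set.range j.left) : ∃ a' : T ⟶ X, a' ≫ j = a := by
  have range_subset : Set.range a.left ⊆ Set.range j.left := Set.range_subset_iff.mpr h
  refine ⟨Over.homMk (IsOpenImmersion.lift j.left a.left range_subset) ?_,
    Over.OverMorphism.ext (IsOpenImmersion.lift_fac _ _ _)⟩
  rw [← Over.w j, IsOpenImmersion.lift_fac_assoc, Over.w]

variable {E H T : Over S}

/-- The image in `H` under `f : E ⊗ T ⟶ H` of the fibre of `E ⊗ T` over a point `t` of `T`. When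
`H` is discrete, it is a locally constant function of `t`, which serves to decompose `T`. -/
def fiberImage (f : E ⊗ T ⟶ H) (t : T.left) : Set H.left :=
  f.left '' ((snd E T).left ⁻¹' {t})

theorem fiberImage_whiskerLeft_comp {T' : Over S} (a : T' ⟶ T) (f : E ⊗ T ⟶ H) (t : T'.left) :
    fiberImage ((E ◁ a) ≫ f) t = fiberImage f (a.left t) := by
  have isPullback := (isPullback_whiskerLeft_snd E a).map (Over.forget S)
  have eq : (E ◁ a).left '' ((snd E T').left ⁻¹' {t}) = (snd E T).left ⁻¹' {a.left t} := by
    ext x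
    constructor
    · rintro ⟨x, rfl, rfl⟩
      exact congrArg (fun g : (E ⊗ T').left ⟶ T.left ↦ g x) isPullback.w
    · intro hx
      obtain ⟨x', h, h'⟩ := Scheme.exists_preimage_of_isPullback isPullback x t hx
      exact ⟨x', h', h⟩
  rw [fiberImage, fiberImage, ← eq, Set.image_image]
  rfl

theorem apply_mem_fiberImage (f : E ⊗ T ⟶ H) (x : (E ⊗ T).left) :
    f.left x ∈ fiberImage f ((snd E T).left x) :=
  ⟨x, rfl, rfl⟩

variable [IsFinite E.hom]

theorem finite_fiberImage (f : E ⊗ T ⟶ H) (t : T.left) : (fiberImage f t).Finite :=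
  ((pullback.snd E.hom T.hom).finite_preimage_singleton t).image _

variable [UniversallyOpen E.hom] [DiscreteTopology H.left]

/-- The open subset of `T` over which the fibres of `E ⊗ T` have image `U` under `f`. -/
def fiberImageLocus (f : E ⊗ T ⟶ H) (U : Finset H.left) : T.left.Opens :=
  ⟨{t | fiberImage f t = U}, isOpen_setOf_image_preimage_singleton_eq
    (pullback.snd E.hom T.hom).isOpenMap (pullback.snd E.hom T.hom).isClosedMap
    f.left.continuous U.finite_toSet⟩

theorem fiberImage_restrictOverι_comp (f : E ⊗ T ⟶ H) (U : Finset H.left)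
    (t : (restrictOver T (fiberImageLocus f U)).left) :
    fiberImage ((E ◁ restrictOverι T (fiberImageLocus f U)) ≫ f) t = U := by
  rw [fiberImage_whiskerLeft_comp]
  exact t.2

theorem IsUniversal.existsUnique_of_fiberImage_eq {V : H.left.Opens} {N : Over S}
    {u : E ⊗ N ⟶ restrictOver H V} (hu : IsUniversal u) {U : Finset H.left}
    (hUV : (U : Set H.left) ⊆ V) (f : E ⊗ T ⟶ H) (hf : ∀ t, fiberImage f t = U) :
    ∃! a : T ⟶ restrictOver N (fiberImageLocus (u ≫ restrictOverι H V) U),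
      (E ◁ a) ≫ (E ◁ restrictOverι N _) ≫ u ≫ restrictOverι H V = f := by
  obtain ⟨f', rfl⟩ := exists_comp_eq_of_forall_mem_range (restrictOverι H V) f fun x ↦
    ⟨⟨f.left x, hUV (hf _ ▸ apply_mem_fiberImage f x)⟩, rfl⟩
  obtain ⟨b, rfl⟩ := (hu T).surjective f'
  obtain ⟨a, rfl⟩ := exists_comp_eq_of_forall_mem_range
    (restrictOverι N (fiberImageLocus (u ≫ restrictOverι H V) U)) b fun t ↦ ⟨⟨b.left t, by
      change fiberImage _ _ = _
      rw [← fiberImage_whiskerLeft_comp, ← hf t, Category.assoc]⟩, rfl⟩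
  refine ⟨a, by simp, fun a' ha' ↦ ?_⟩
  rw [← cancel_mono (restrictOverι N _)]
  refine (hu T).injective ?_
  rw [← cancel_mono (restrictOverι H V)]
  simpa using ha'

end FiberImage

section Coproduct

variable {S : Scheme.{u}} {ι : Type u} (M : ι → Over S)

/-- The scheme underlying a coproduct of `S`-schemes is the coproduct of the underlying schemes. -/
def sigmaLeftIso : (∐ fun i ↦ (M i).left) ≅ (∐ M).left :=
  (PreservesCoproduct.iso (Over.forget S) M).symm

theorem ι_sigmaLeftIso_hom (i : ι) :
    Sigma.ι (fun i ↦ (M i).left) i ≫ (sigmaLeftIso M).hom = (Sigma.ι M i).left :=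
  ι_comp_sigmaComparison (Over.forget S) M i

instance isOpenImmersion_sigmaι_left (i : ι) : IsOpenImmersion (Sigma.ι M i).left := by
  rw [← ι_sigmaLeftIso_hom]
  infer_instance

theorem exists_sigmaι_left_eq (x : (∐ M).left) : ∃ i y, (Sigma.ι M i).left y = x := by
  obtain ⟨z, rfl⟩ := (sigmaLeftIso M).hom.surjective x
  obtain ⟨(i : ι), y, rfl⟩ := (sigmaOpenCover fun i ↦ (M i).left).exists_eq z
  refine ⟨i, y, ?_⟩
  rw [← ι_sigmaLeftIso_hom]
  exact Scheme.Hom.comp_apply _ _ y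

theorem isEmpty_left_of_comp_sigmaι_eq {T : Over S} {i i' : ι} (h : i ≠ i') {a : T ⟶ M i}
    {b : T ⟶ M i'} (hab : a ≫ Sigma.ι M i = b ≫ Sigma.ι M i') : IsEmpty T.left := by
  refine isEmpty_of_commSq_sigmaι_of_ne (g := fun i ↦ (M i).left) (a := a.left) (b := b.left) ⟨?_⟩ h
  rw [← cancel_mono (sigmaLeftIso M).hom, Category.assoc, Category.assoc, ι_sigmaLeftIso_hom,
    ι_sigmaLeftIso_hom]
  exact congrArg (·.left) hab

theorem etale_sigma_hom [∀ i, Etale (M i).hom] : Etale (∐ M).hom := by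
  have : IsZariskiLocalAtSource.{u} @Etale :=
    HasRingHomProperty.instIsZariskiLocalAtSource (Q := RingHom.Etale)
  let 𝒰 : (∐ M).left.OpenCover :=
    .mkOfCovers ι _ (fun i ↦ (Sigma.ι M i).left) (exists_sigmaι_left_eq M)
  refine (IsZariskiLocalAtSource.iff_of_openCover (P := @Etale) 𝒰).mpr fun i ↦ ?_
  exact (Over.w (Sigma.ι M i)).symm ▸ ‹∀ i, Etale (M i).hom› i

variable {M}

theorem exists_whiskerLeft_sigmaι_comp_eq {E H : Over S} (w : ∀ i, E ⊗ M i ⟶ H) :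
    ∃ u : E ⊗ ∐ M ⟶ H, ∀ i, (E ◁ Sigma.ι M i) ≫ u = w i := by
  refine exists_comp_eq_of_covers (fun i ↦ E ◁ Sigma.ι M i)
    (exists_whiskerLeft_left_eq _ (exists_sigmaι_left_eq M) E) w fun i i' T a b hab ↦ ?_
  obtain rfl | h := eq_or_ne i i'
  · rw [(cancel_mono (E ◁ Sigma.ι M i)).mp hab]
  · have hab' : (a ≫ CartesianMonoidalCategory.snd _ _) ≫ Sigma.ι M i =
        (b ≫ CartesianMonoidalCategory.snd _ _) ≫ Sigma.ι M i' := by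
      simpa using congrArg (· ≫ CartesianMonoidalCategory.snd _ _) hab
    have : IsEmpty T.left := isEmpty_left_of_comp_sigmaι_eq M h hab'
    exact Over.OverMorphism.ext (isInitialOfIsEmpty.hom_ext _ _)

end Coproduct

section DiscreteTarget

variable {S : Scheme.{u}} {E H : Over S} [IsFinite E.hom] [UniversallyOpen E.hom]
  [DiscreteTopology H.left]

theorem isUniversal_of_existsUnique_of_fiberImage_eq {M : Finset H.left → Over S}
    {u : E ⊗ ∐ M ⟶ H}
    (fiberImage_eq : ∀ (U : Finset H.left) m, fiberImage ((E ◁ Sigma.ι M U) ≫ u) m = U)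
    (existsUnique : ∀ (U : Finset H.left) (T : Over S) (f : E ⊗ T ⟶ H), (∀ t, fiberImage f t = U) →
      ∃! a : T ⟶ M U, (E ◁ a) ≫ (E ◁ Sigma.ι M U) ≫ u = f) : IsUniversal u := by
  have exists_factor {T : Over S} (a : T ⟶ ∐ M) (U : Finset H.left)
      (h : ∀ t, fiberImage ((E ◁ a) ≫ u) t = U) : ∃ a' : T ⟶ M U, a' ≫ Sigma.ι M U = a := by
    refine exists_comp_eq_of_forall_mem_range (Sigma.ι M U) a fun t ↦ ?_
    obtain ⟨U', m, hm⟩ := exists_sigmaι_left_eq M (a.left t)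
    obtain rfl : U' = U := by
      rw [← Finset.coe_inj, ← fiberImage_eq U' m, ← h t, fiberImage_whiskerLeft_comp,
        fiberImage_whiskerLeft_comp, hm]
    exact ⟨m, hm⟩
  have injective {T : Over S} {a b : T ⟶ ∐ M} (hab : (E ◁ a) ≫ u = (E ◁ b) ≫ u)
      (U : Finset H.left) (h : ∀ t, fiberImage ((E ◁ a) ≫ u) t = U) : a = b := by
    obtain ⟨a', rfl⟩ := exists_factor a U h
    obtain ⟨b', rfl⟩ := exists_factor b U (hab ▸ h)
    rw [whiskerLeft_comp_assoc, whiskerLeft_comp_assoc] at hab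
    rw [whiskerLeft_comp_assoc] at h
    rw [(existsUnique U T _ h).unique rfl hab.symm]
  refine isUniversal_of_local u (fun T a b hab t ↦ ?_) fun T f t ↦ ?_
  · let U := (finite_fiberImage ((E ◁ a) ≫ u) t).toFinset
    refine ⟨fiberImageLocus ((E ◁ a) ≫ u) U, (Set.Finite.coe_toFinset _).symm, injective ?_ U ?_⟩
    · simp only [whiskerLeft_comp, Category.assoc, hab]
    · simpa only [whiskerLeft_comp, Category.assoc] using
        fiberImage_restrictOverι_comp ((E ◁ a) ≫ u) U
  · let U := (finite_fiberImage f t).toFinset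
    obtain ⟨a, ha, -⟩ := existsUnique U _ _ (fiberImage_restrictOverι_comp f U)
    exact ⟨fiberImageLocus f U, (Set.Finite.coe_toFinset _).symm, a ≫ Sigma.ι M U, by
      rw [whiskerLeft_comp_assoc, ha]⟩

theorem exists_isUniversal_of_forall_finite
    (exists_of_finite : ∀ V : H.left.Opens, (V : Set H.left).Finite →
      ∃ (N : Over S) (u : E ⊗ N ⟶ restrictOver H V), IsUniversal u ∧ Etale N.hom) :
    ∃ (N : Over S) (u : E ⊗ N ⟶ H), IsUniversal u ∧ Etale N.hom := by
  let V (U : Finset H.left) : H.left.Opens := ⟨U, isOpen_discrete _⟩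
  choose N v isUniversal etale using fun U ↦ exists_of_finite (V U) U.finite_toSet
  let w (U : Finset H.left) : E ⊗ N U ⟶ H := v U ≫ restrictOverι H (V U)
  let M (U : Finset H.left) : Over S := restrictOver (N U) (fiberImageLocus (w U) U)
  obtain ⟨u, hu⟩ := exists_whiskerLeft_sigmaι_comp_eq fun U ↦
    (E ◁ restrictOverι (N U) (fiberImageLocus (w U) U)) ≫ w U
  have (U : Finset H.left) : Etale (M U).hom :=
    inferInstanceAs (Etale ((fiberImageLocus (w U) U).ι ≫ (N U).hom))
  refine ⟨∐ M, u, isUniversal_of_existsUnique_of_fiberImage_eq (fun U ↦ ?_) fun U T f hf ↦ ?_,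
    etale_sigma_hom M⟩
  · rw [hu]
    exact fiberImage_restrictOverι_comp (w U) U
  · rw [hu]
    exact (isUniversal U).existsUnique_of_fiberImage_eq subset_rfl f hf

end DiscreteTarget

section EtaleTarget

variable {k : Type u} [Field k]

theorem exists_isUniversal_of_etale (E H : Over (Spec (.of k))) [IsFinite E.hom] [Etale H.hom] :
    ∃ (N : Over (Spec (.of k))) (u : E ⊗ N ⟶ H),
      IsUniversal u ∧ Etale N.hom ∧ (IsFinite H.hom → IsFinite N.hom) := by
  by_cases hH : IsFinite H.hom
  · have : IsAffine H.left := isAffine_of_isAffineHom H.hom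
    obtain ⟨N, u, hu, _, _⟩ := exists_isUniversal_of_isAffine E H
    have := locallyQuasiFinite_of_formallyUnramified N.hom
    exact ⟨N, u, hu, ‹_›, fun _ ↦ .of_locallyQuasiFinite N.hom⟩
  · have := discreteTopology_of_etale H.hom
    obtain ⟨N, u, hu, hN⟩ := exists_isUniversal_of_forall_finite (E := E) (H := H) fun V hV ↦ by
      have : Finite V := hV
      have : DiscreteTopology V := inferInstanceAs (DiscreteTopology (V : Set H.left))
      have : IsAffine (restrictOver H V).left := inferInstanceAs (IsAffine V.toScheme)
      have : Etale (restrictOver H V).hom := inferInstanceAs (Etale (V.ι ≫ H.hom))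
      obtain ⟨N, u, hu, hN, -⟩ := exists_isUniversal_of_isAffine E (restrictOver H V)
      exact ⟨N, u, hu, hN⟩
    exact ⟨N, u, hu, hN, fun h ↦ absurd h hH⟩

theorem IsUniversal.exists_iso_homFunctor {E N H : Over (Spec (.of k))} [GrpObj H]
    {u : E ⊗ N ⟶ H} (hu : IsUniversal u) :
    ∃ _ : GrpObj N, Nonempty (yonedaGrpObj N ≅ homFunctor E H) := by
  let r : (homFunctor E H ⋙ forget GrpCat).RepresentableBy N :=
    { homEquiv := fun {T} ↦ Equiv.ofBijective (fun a : T ⟶ N ↦ (E ◁ a) ≫ u) (hu T)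
      homEquiv_comp := fun f g ↦ whiskerLeft_comp_assoc E f g u }
  exact ⟨GrpObj.ofRepresentableBy N _ r, ⟨yonedaGrpObjIsoOfRepresentableBy N _ r⟩⟩

end EtaleTarget

end HomEtale

end

theorem proposition4p1_general {k : Type u} [Field k] (X : Over (Spec (.of k)))
    [LocallyOfFiniteType X.hom] [QuasiCompact X.hom] (H : Over (Spec (.of k))) [GrpObj H]
    [Etale H.hom] :
    IsIso (HomEtale.homFunctorPullback (HomEtale.toPiZero X) H) ∧
    ∃ (N : Over (Spec (.of k))) (_ : GrpObj N),
      Nonempty (yonedaGrpObj N ≅ HomEtale.homFunctor X H) ∧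
      Etale N.hom ∧
      (IsFinite H.hom → IsFinite N.hom) := by
  have isIso := HomEtale.isIso_homFunctorPullback_toPiZero X H
  have := HomEtale.isFinite_piZero_hom X
  obtain ⟨N, u, hu, etale, finite⟩ := HomEtale.exists_isUniversal_of_etale (HomEtale.piZero X) H
  obtain ⟨_, ⟨e⟩⟩ := hu.exists_iso_homFunctor
  exact ⟨isIso, N, _, ⟨e ≪≫ asIso (HomEtale.homFunctorPullback (HomEtale.toPiZero X) H)⟩,
    etale, finite⟩

/-- `G` is an algebraic group (a group scheme of finite type) over the field `k`, and `H` is an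
étale `k`-group scheme. -/
theorem proposition4p1 {k : Type u} [Field k]
    (G : Over (Spec (.of k))) [GrpObj G] [LocallyOfFiniteType G.hom] [QuasiCompact G.hom]
    (H : Over (Spec (.of k))) [GrpObj H] [Etale H.hom] :
    IsIso (HomEtale.homFunctorPullback (HomEtale.toPiZero G) H) ∧
    ∃ (N : Over (Spec (.of k))) (_ : GrpObj N),
      Nonempty (yonedaGrpObj N ≅ HomEtale.homFunctor G H) ∧
      Etale N.hom ∧
      (IsFinite H.hom → IsFinite N.hom) :=
  proposition4p1_general G H
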